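/- Let $\mathsf{T}:\mathbb{Z}^+\to\mathbb{Z}^+$ be the map given by $\mathsf{T}(m)=\frac{m}{2}$ if $m$ is even and $\mathsf{T}(m)=\frac{3m+1}{2}$ if $m$ is odd, and let $\mathsf{T}^k$ denote its $k$-th iterate. A set $A\subseteq\mathbb{Z}^+$ is said to be of natural density $1$ if $\liminf_{n\to\infty}\frac{\#\{m\in A\mid m\le n\}}{n}=1$. Then for every real $\epsilon>0$ the set $$\left\{m\in\mathbb{Z}^+\ \middle|\ \forall \lambda\in[0,1]:\ m^{\lambda-\epsilon}\le \mathsf{T}^{\left\lfloor\frac{1-\lambda}{1-\log_2\sqrt{3}}\log_2 m\right\rfloor}(m)\le m^{\lambda+\epsilon}\right\}$$ is of natural density $1$. -/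

import Mathlib

/-- The shortened Collatz map (the `3x+1`-function): `m / 2` for even `m`, `(3m+1)/2` for odd `m`.
The natural-number divisions are exact, and positive integers are sent to positive integers
(see `collatzT_pos`). -/
def collatzT (m : ℕ) : ℕ := if Even m then m / 2 else (3 * m + 1) / 2

theorem collatzT_pos {m : ℕ} (hm : 0 < m) : 0 < collatzT m := by
  unfold collatzT
  split_ifs with h
  · obtain ⟨r, hr⟩ := h
    omega
  · omega

theorem two_mul_collatzT (m : ℕ) : 2 * collatzT m = if Even m then m else 3 * m + 1 := by
  unfold collatzT
  split_ifs with h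
  · obtain ⟨r, hr⟩ := h
    omega
  · rw [Nat.not_even_iff_odd] at h
    obtain ⟨r, hr⟩ := h
    omega

/-- A set `A` of positive integers has natural density `1` if
`liminf_{n → ∞} #{m ∈ A | 1 ≤ m ≤ n} / n = 1`. -/
def HasNaturalDensityOne (A : Set ℕ) : Prop :=
  Filter.liminf (fun n : ℕ => ((A ∩ Set.Icc 1 n).ncard : ℝ) / (n : ℝ)) Filter.atTop = 1

/-!
Write `a_j(m)` for the number of odd terms among `m, T m, …, T^(j-1) m`. Then
`2 ^ j * T^j m = 3 ^ a_j(m) * (m + corr j m)` with a correction term `corr j m ≥ 0`, so the theorem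
follows once `a_j(m)` is close to `j / 2` for almost all `m`, for all times `j` up to
`log₂ m / (1 - σ)`, where `σ = log₂ √3`. This is `Balanced (1 / (1 - σ))`, which also asserts that
the exceptional starting points below `2 ^ n` number at most `2 ^ ((1 - δ) * n)`.

For `j ≤ n` the parities of the first `n` terms are exactly independent and unbiased for uniform
`m < 2 ^ n`, and Chernoff's bound gives `Balanced 1`. Going beyond time `n` requires control of the
distribution of `T^n m`. A regular `m < 2 ^ n` has `T^n m` of size about `2 ^ (σ * n)`, and the key
observation is that a point has not many more regular preimages under `T^n` than the expected
`2 ^ ((1 - σ) * n)` (`card_le_of_iterate_mem`). To see this, split `n = k + L`. Two starting points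
with the same residue modulo `2 ^ k`, the same endpoint and the same number of odd steps differ by
`2 ^ k / 3 ^ a` times the difference of the correction terms of the last `L` steps, where `a` counts
the odd ones among the first `k` steps. As they also differ by a multiple of `2 ^ k`, they coincide
as soon as these correction terms, of order `2 ^ ((1 - σ) * L)` on regular orbits, are below
`3 ^ a ≈ 2 ^ (σ * k)` (`eq_of_iterate_eq`). Regularity permits this already for `k` slightly above
`(1 - σ) * n`.

Hence an exceptional set that is smaller by a power at scale `2 ^ (σ * n)` pulls back to one that is
smaller by a power at scale `2 ^ n`, and `Balanced K` implies `Balanced (1 + σ * K)`. Iteration from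
`K = 0` reaches every `K` below the fixed point `1 / (1 - σ)`, and the fixed point itself follows
because a few more steps hardly change `a_j`.
-/

namespace Collatz

open Filter Topology

/-! ### Parities along an orbit -/

/-- The number of odd terms among the first `j` terms `m, T m, …, T^(j-1) m` of the orbit of `m`. -/
def oddCount (j m : ℕ) : ℕ := Nat.count (fun i => collatzT^[i] m % 2 = 1) j

@[simp] lemma oddCount_zero (m : ℕ) : oddCount 0 m = 0 := by simp [oddCount]

lemma oddCount_succ (j m : ℕ) :
    oddCount (j + 1) m = oddCount j m + if collatzT^[j] m % 2 = 1 then 1 else 0 := by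
  simp [oddCount, Nat.count_succ]

lemma oddCount_add (j i m : ℕ) :
    oddCount (j + i) m = oddCount j m + oddCount i (collatzT^[j] m) := by
  simp only [oddCount, Nat.count_add]
  congr 2
  ext k
  rw [add_comm j k, Function.iterate_add_apply]

lemma oddCount_le (j m : ℕ) : oddCount j m ≤ j := Nat.count_le _

lemma collatzT_two_mul (q : ℕ) : collatzT (2 * q) = q := by
  simp [collatzT]

lemma collatzT_two_mul_add_one (q : ℕ) : collatzT (2 * q + 1) = 3 * q + 2 := by
  have := two_mul_collatzT (2 * q + 1)
  rw [if_neg (by simp [parity_simps])] at this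
  omega

lemma oddCount_succ_two_mul (j q : ℕ) : oddCount (j + 1) (2 * q) = oddCount j q := by
  rw [add_comm, oddCount_add, oddCount_succ]
  simp [collatzT_two_mul]

lemma oddCount_succ_two_mul_add_one (j q : ℕ) :
    oddCount (j + 1) (2 * q + 1) = oddCount j (3 * q + 2) + 1 := by
  rw [add_comm, oddCount_add, oddCount_succ]
  have h : (2 * q + 1) % 2 = 1 := by omega
  simp [collatzT_two_mul_add_one, h, add_comm 1]

/-- The parities of the first `j` terms of an orbit depend only on the residue of its starting
point modulo `2 ^ j`. -/
lemma parity_congr {j : ℕ} : ∀ {m m' : ℕ}, m ≡ m' [MOD 2 ^ j] → ∀ i < j,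
    collatzT^[i] m % 2 = collatzT^[i] m' % 2 := by
  induction j with
  | zero => intro m m' _ i hi; omega
  | succ j ih =>
    intro m m' h i hi
    have h2 : m % 2 = m' % 2 := h.of_dvd (by rw [pow_succ]; exact Dvd.intro_left _ rfl)
    rcases i with _ | i
    · simpa using h2
    · simp only [Function.iterate_succ_apply]
      refine ih ?_ i (by omega)
      rcases Nat.even_or_odd' m with ⟨q, rfl | rfl⟩ <;>
        rcases Nat.even_or_odd' m' with ⟨r, rfl | rfl⟩ <;> try omega
      · rw [collatzT_two_mul, collatzT_two_mul]
        rw [pow_succ'] at h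
        exact Nat.ModEq.mul_left_cancel' (by norm_num) h
      · rw [collatzT_two_mul_add_one, collatzT_two_mul_add_one]
        rw [pow_succ'] at h
        have := Nat.ModEq.add_right_cancel' 1 h
        exact ((Nat.ModEq.mul_left_cancel' (by norm_num) this).mul_left 3).add_right 2

lemma oddCount_congr {j m m' : ℕ} (h : m ≡ m' [MOD 2 ^ j]) {i : ℕ} (hi : i ≤ j) :
    oddCount i m = oddCount i m' := by
  induction i with
  | zero => simp
  | succ i ih => rw [oddCount_succ, oddCount_succ, ih (by omega), parity_congr h i (by omega)]

/-! ### The correction term -/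

/-- The correction term in `2 ^ j * T^j m = 3 ^ a * (m + corr j m)`, where `a = oddCount j m`:
it collects the effect of the summands `+ 1` in the odd steps. -/
noncomputable def corr (j m : ℕ) : ℝ :=
  2 ^ j * (collatzT^[j] m : ℝ) / 3 ^ oddCount j m - m

lemma two_pow_mul_iterate (j m : ℕ) :
    2 ^ j * (collatzT^[j] m : ℝ) = 3 ^ oddCount j m * (m + corr j m) := by
  unfold corr
  field_simp
  ring

@[simp] lemma corr_zero (m : ℕ) : corr 0 m = 0 := by simp [corr]

lemma corr_succ (j m : ℕ) : corr (j + 1) m =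
    corr j m + if collatzT^[j] m % 2 = 1 then 2 ^ j / 3 ^ (oddCount j m + 1) else 0 := by
  have h := two_mul_collatzT (collatzT^[j] m)
  rw [← Function.iterate_succ_apply' collatzT] at h
  have h' : (2 : ℝ) * (collatzT^[j + 1] m : ℕ) =
      ((if Even (collatzT^[j] m) then collatzT^[j] m else 3 * collatzT^[j] m + 1 : ℕ) : ℝ) := by
    rw [← h]; push_cast; rfl
  unfold corr
  rw [pow_succ, mul_assoc, h', oddCount_succ]
  by_cases ho : collatzT^[j] m % 2 = 1
  · rw [if_neg (by rw [Nat.even_iff]; omega), if_pos ho, if_pos ho]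
    push_cast
    field_simp
    ring
  · rw [if_pos (by rw [Nat.even_iff]; omega), if_neg ho, if_neg ho]
    simp

lemma corr_nonneg (j m : ℕ) : 0 ≤ corr j m := by
  induction j with
  | zero => simp
  | succ j ih => rw [corr_succ]; split_ifs <;> positivity

lemma corr_add (j i m : ℕ) :
    corr (j + i) m = corr j m + 2 ^ j / 3 ^ oddCount j m * corr i (collatzT^[j] m) := by
  unfold corr
  rw [oddCount_add, add_comm j i, Function.iterate_add_apply, pow_add, pow_add]
  field_simp
  ring

lemma corr_congr {j m m' : ℕ} (h : m ≡ m' [MOD 2 ^ j]) {i : ℕ} (hi : i ≤ j) :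
    corr i m = corr i m' := by
  induction i with
  | zero => simp
  | succ i ih =>
    rw [corr_succ, corr_succ, ih (by omega), parity_congr h i (by omega),
      oddCount_congr h (by omega : i ≤ j)]

/-- A starting point is recovered from its residue modulo `2 ^ k`, the endpoint of its orbit of
length `k + L`, and the number of odd steps, as soon as the correction accumulated in the last `L`
steps is smaller than `3 ^ a`, where `a` counts the odd steps among the first `k`. -/
lemma eq_of_iterate_eq {k L m m' : ℕ} (hmod : m ≡ m' [MOD 2 ^ k])
    (hT : collatzT^[k + L] m = collatzT^[k + L] m')
    (ha : oddCount (k + L) m = oddCount (k + L) m')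
    (hm : corr L (collatzT^[k] m) < 3 ^ oddCount k m)
    (hm' : corr L (collatzT^[k] m') < 3 ^ oddCount k m') : m = m' := by
  have e1 := two_pow_mul_iterate (k + L) m
  have e2 := two_pow_mul_iterate (k + L) m'
  rw [hT, e2, ha] at e1
  have e3 := mul_left_cancel₀ (by positivity) e1
  rw [corr_add, corr_add, corr_congr hmod le_rfl, oddCount_congr hmod le_rfl] at e3
  rw [oddCount_congr hmod le_rfl] at hm
  have n1 := corr_nonneg L (collatzT^[k] m)
  have n2 := corr_nonneg L (collatzT^[k] m')
  set a := oddCount k m'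
  set x := corr L (collatzT^[k] m)
  set y := corr L (collatzT^[k] m')
  have e4 : (m' : ℝ) - m = 2 ^ k / 3 ^ a * (x - y) := by linarith
  have hxy : |x - y| < 3 ^ a := by rw [abs_lt]; constructor <;> linarith
  have h5 : |(m' : ℝ) - m| < 2 ^ k := by
    rw [e4, abs_mul, abs_of_pos (by positivity : (0 : ℝ) < 2 ^ k / 3 ^ a)]
    calc (2 : ℝ) ^ k / 3 ^ a * |x - y| < 2 ^ k / 3 ^ a * 3 ^ a := by gcongr
      _ = 2 ^ k := by field_simp
  have h6 : |(m' : ℤ) - m| < 2 ^ k := by exact_mod_cast h5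
  have h7 := Int.eq_zero_of_abs_lt_dvd (by simpa using (Nat.modEq_iff_dvd.mp hmod)) h6
  omega

/-! ### Equidistribution of parities -/

/-- Sums over an initial segment of even length, split by parity. -/
lemma sum_range_two_mul (f : ℕ → ℝ) (N : ℕ) :
    ∑ m ∈ Finset.range (2 * N), f m =
      ∑ q ∈ Finset.range N, f (2 * q) + ∑ q ∈ Finset.range N, f (2 * q + 1) := by
  induction N with
  | zero => simp
  | succ N ih =>
    rw [show 2 * (N + 1) = 2 * N + 1 + 1 by ring, Finset.sum_range_succ, Finset.sum_range_succ, ih,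
      Finset.sum_range_succ, Finset.sum_range_succ]
    ring

/-- The map `q ↦ 3 * q + 2` permutes the residues modulo `2 ^ n`. -/
lemma sum_range_three_mul_add_two (f : ℕ → ℝ) (n : ℕ)
    (hf : ∀ m m', m ≡ m' [MOD 2 ^ n] → f m = f m') :
    ∑ q ∈ Finset.range (2 ^ n), f (3 * q + 2) = ∑ q ∈ Finset.range (2 ^ n), f q := by
  have hinj : Set.InjOn (fun q => (3 * q + 2) % 2 ^ n) (Finset.range (2 ^ n) : Set ℕ) := by
    intro q hq r hr h
    simp only [Finset.coe_range, Set.mem_Iio] at hq hr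
    have h1 : 3 * q ≡ 3 * r [MOD 2 ^ n] := Nat.ModEq.add_right_cancel' 2 h
    have h2 := Nat.ModEq.cancel_left_of_coprime
      (by rw [Nat.coprime_iff_gcd_eq_one.symm]; exact Nat.Coprime.pow_left _ (by norm_num)) h1
    rwa [Nat.ModEq, Nat.mod_eq_of_lt hq, Nat.mod_eq_of_lt hr] at h2
  have himg : (Finset.range (2 ^ n)).image (fun q => (3 * q + 2) % 2 ^ n)
      = Finset.range (2 ^ n) := by
    refine Finset.eq_of_subset_of_card_le ?_ (by rw [Finset.card_image_of_injOn hinj])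
    intro x hx
    obtain ⟨q, -, rfl⟩ := Finset.mem_image.mp hx
    exact Finset.mem_range.mpr (Nat.mod_lt _ (by positivity))
  conv_rhs => rw [← himg, Finset.sum_image hinj]
  exact Finset.sum_congr rfl fun q _ => hf _ _ (Nat.mod_modEq _ _).symm

/-- For a uniformly distributed starting point below `2 ^ (j + i)`, the number of odd terms among the
first `j` has the binomial distribution of `j` fair coin tosses, here in terms of its generating
function. -/
lemma sum_pow_oddCount (x : ℝ) (j i : ℕ) :
    ∑ m ∈ Finset.range (2 ^ (j + i)), x ^ oddCount j m = 2 ^ i * (1 + x) ^ j := by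
  induction j with
  | zero => simp
  | succ j ih =>
    rw [show j + 1 + i = j + i + 1 by ring, pow_succ', sum_range_two_mul]
    simp only [oddCount_succ_two_mul, oddCount_succ_two_mul_add_one, pow_succ x]
    rw [← Finset.sum_mul, sum_range_three_mul_add_two (fun q => x ^ oddCount j q), ih]
    · ring
    · intro m m' h
      rw [oddCount_congr h (by omega)]

/-- Chernoff's bound for the number of odd steps. -/
lemma card_deviation_le (ε : ℝ) (hε : 0 < ε) {j n : ℕ} (hj : j ≤ n) :
    (((Finset.range (2 ^ n)).filter
      (fun m => ε * n < |(oddCount j m : ℝ) - j / 2|)).card : ℝ)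
      ≤ 2 * 2 ^ n * Real.exp (-2 * ε ^ 2 * n) := by
  obtain ⟨i, rfl⟩ := Nat.exists_eq_add_of_le hj
  set N := j + i
  have hmgf : ∀ t : ℝ, ∑ m ∈ Finset.range (2 ^ N), Real.exp (t * ((oddCount j m : ℝ) - j / 2))
      ≤ 2 ^ N * Real.exp (j * t ^ 2 / 8) := by
    intro t
    have h1 : ∀ m, Real.exp (t * ((oddCount j m : ℝ) - j / 2)) =
        Real.exp t ^ oddCount j m * Real.exp (-t / 2) ^ j := by
      intro m
      rw [← Real.exp_nat_mul, ← Real.exp_nat_mul, ← Real.exp_add]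
      ring_nf
    simp_rw [h1]
    rw [← Finset.sum_mul, sum_pow_oddCount, mul_assoc, ← mul_pow]
    have h2 : (1 + Real.exp t) * Real.exp (-t / 2) = 2 * Real.cosh (t / 2) := by
      rw [Real.cosh_eq, add_mul, ← Real.exp_add]
      ring_nf
    rw [h2, mul_pow, ← mul_assoc, ← pow_add, add_comm i j]
    refine mul_le_mul_of_nonneg_left ?_ (by positivity)
    calc Real.cosh (t / 2) ^ j ≤ Real.exp ((t / 2) ^ 2 / 2) ^ j :=
          pow_le_pow_left₀ (Real.cosh_pos _).le (Real.cosh_le_exp_half_sq _) _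
      _ = Real.exp (j * t ^ 2 / 8) := by rw [← Real.exp_nat_mul]; ring_nf
  -- The exponent `t = 4 * ε` is the optimal choice for `j = n`.
  have hsum : (((Finset.range (2 ^ N)).filter
      (fun m => ε * N < |(oddCount j m : ℝ) - j / 2|)).card : ℝ) * Real.exp (4 * ε * (ε * N))
      ≤ ∑ m ∈ Finset.range (2 ^ N), (Real.exp (4 * ε * ((oddCount j m : ℝ) - j / 2)) +
        Real.exp (-(4 * ε) * ((oddCount j m : ℝ) - j / 2))) := by
    rw [← nsmul_eq_mul]
    refine (Finset.card_nsmul_le_sum _ (fun m => Real.exp (4 * ε * ((oddCount j m : ℝ) - j / 2)) +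
        Real.exp (-(4 * ε) * ((oddCount j m : ℝ) - j / 2))) _ ?_).trans ?_
    · intro m hm
      have hm' := (Finset.mem_filter.mp hm).2
      rcases lt_abs.mp hm' with h | h
      · have : Real.exp (4 * ε * (ε * N)) ≤ Real.exp (4 * ε * ((oddCount j m : ℝ) - j / 2)) := by
          gcongr
        have := Real.exp_pos (-(4 * ε) * ((oddCount j m : ℝ) - j / 2))
        linarith
      · have : Real.exp (4 * ε * (ε * N)) ≤ Real.exp (-(4 * ε) * ((oddCount j m : ℝ) - j / 2)) := by
          rw [neg_mul, ← mul_neg]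
          gcongr
        have := Real.exp_pos ((4 * ε) * ((oddCount j m : ℝ) - j / 2))
        linarith
    · exact Finset.sum_le_sum_of_subset_of_nonneg (Finset.filter_subset _ _)
        (fun _ _ _ => by positivity)
  rw [Finset.sum_add_distrib] at hsum
  have h1 := hmgf (4 * ε)
  have h2 := hmgf (-(4 * ε))
  have hjN : (j : ℝ) ≤ N := by exact_mod_cast hj
  have h3 : Real.exp (j * (4 * ε) ^ 2 / 8) ≤ Real.exp (2 * ε ^ 2 * N) := by
    apply Real.exp_le_exp.mpr
    nlinarith [sq_nonneg ε]
  rw [neg_sq] at h2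
  have h4 : (2 : ℝ) ^ N * Real.exp (j * (4 * ε) ^ 2 / 8) ≤ 2 ^ N * Real.exp (2 * ε ^ 2 * N) := by
    gcongr
  have h5 : Real.exp (-2 * ε ^ 2 * N) = Real.exp (2 * ε ^ 2 * N) / Real.exp (4 * ε * (ε * N)) := by
    rw [← Real.exp_sub]; ring_nf
  rw [h5, mul_div_assoc', le_div_iff₀ (Real.exp_pos _)]
  linarith

/-! ### Size of regular orbits -/

/-- `σ = log₂ √3 ≈ 0.79`, so that two steps, one odd and one even, multiply a large number by about
`3 / 4 = 2 ^ (-2 * (1 - σ))`. -/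
noncomputable def σ : ℝ := Real.logb 2 (Real.sqrt 3)

lemma two_rpow_σ : (2 : ℝ) ^ (2 * σ) = 3 := by
  rw [mul_comm, Real.rpow_mul (by norm_num), σ, Real.rpow_logb (by norm_num) (by norm_num)
    (by positivity)]
  norm_num

lemma σ_pos : 0 < σ :=
  Real.logb_pos (by norm_num) (by rw [Real.lt_sqrt] <;> norm_num)

lemma σ_lt_one : σ < 1 := by
  by_contra! h
  have : (2 : ℝ) ^ (2 : ℝ) ≤ 2 ^ (2 * σ) := Real.rpow_le_rpow_of_exponent_le (by norm_num)
    (by linarith)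
  rw [two_rpow_σ] at this
  norm_num at this

lemma three_pow (a : ℕ) : (3 : ℝ) ^ a = 2 ^ (2 * σ * a) := by
  rw [Real.rpow_mul (by norm_num), two_rpow_σ, Real.rpow_natCast]

/-- If the odd steps are never much rarer than the even ones, then the correction term is not much
larger than `(2 / √3) ^ j = 2 ^ ((1 - σ) * j)`. -/
lemma corr_le {j m : ℕ} {D : ℝ} (h : ∀ i ≤ j, (i : ℝ) / 2 - D ≤ oddCount i m) :
    corr j m ≤ j * 2 ^ ((1 - σ) * j + 2 * σ * D) := by
  have h1 : ∀ i < j, (2 : ℝ) ^ i / 3 ^ (oddCount i m + 1) ≤ 2 ^ ((1 - σ) * j + 2 * σ * D) := by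
    intro i hi
    have hi' : (i : ℝ) ≤ j := by exact_mod_cast hi.le
    calc (2 : ℝ) ^ i / 3 ^ (oddCount i m + 1) ≤ 2 ^ i / 3 ^ oddCount i m := by
          gcongr <;> norm_num
      _ = 2 ^ ((i : ℝ) - 2 * σ * oddCount i m) := by
          rw [three_pow, Real.rpow_sub (by norm_num), Real.rpow_natCast]
      _ ≤ _ := by
          apply Real.rpow_le_rpow_of_exponent_le (by norm_num)
          nlinarith [h i hi.le, σ_pos, σ_lt_one]
  have h2 : ∀ i ≤ j, corr i m ≤ i * 2 ^ ((1 - σ) * j + 2 * σ * D) := by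
    intro i
    induction i with
    | zero => simp
    | succ i ih =>
      intro hi
      rw [corr_succ]
      have := ih (by omega)
      have h3 := h1 i (by omega)
      have h4 : (0 : ℝ) < 2 ^ ((1 - σ) * j + 2 * σ * D) := by positivity
      push_cast
      split_ifs <;> linarith
  exact h2 j le_rfl

lemma le_iterate {j m : ℕ} {D x : ℝ} (h : (j : ℝ) / 2 - D ≤ oddCount j m) (hx : 2 ^ x ≤ (m : ℝ)) :
    2 ^ (x - (1 - σ) * j - 2 * σ * D) ≤ (collatzT^[j] m : ℝ) := by
  have h1 := two_pow_mul_iterate j m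
  have h2 : (2 : ℝ) ^ j * 2 ^ (x - (1 - σ) * j - 2 * σ * D) ≤ 2 ^ j * (collatzT^[j] m : ℝ) := by
    rw [h1, three_pow, ← Real.rpow_natCast 2 j, ← Real.rpow_add (by norm_num)]
    calc (2 : ℝ) ^ ((j : ℝ) + (x - (1 - σ) * j - 2 * σ * D)) ≤ 2 ^ (2 * σ * oddCount j m + x) := by
          apply Real.rpow_le_rpow_of_exponent_le (by norm_num)
          nlinarith [σ_pos]
      _ = 2 ^ (2 * σ * oddCount j m) * 2 ^ x := Real.rpow_add (by norm_num) _ _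
      _ ≤ _ := by
          gcongr
          linarith [corr_nonneg j m]
  exact le_of_mul_le_mul_left h2 (by positivity)

lemma iterate_le {j m : ℕ} {D x : ℝ} (hD : 0 ≤ D)
    (h : ∀ i ≤ j, |(oddCount i m : ℝ) - i / 2| ≤ D) (hx : (m : ℝ) ≤ 2 ^ x)
    (hj : (1 - σ) * j ≤ x) :
    (collatzT^[j] m : ℝ) ≤ (j + 1) * 2 ^ (x - (1 - σ) * j + 4 * σ * D) := by
  have h1 := two_pow_mul_iterate j m
  have hc := corr_le (j := j) (m := m) (D := D) (fun i hi => by linarith [(abs_le.mp (h i hi)).1])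
  have ha := (abs_le.mp (h j le_rfl)).2
  have hσ := σ_pos
  have hm : m + corr j m ≤ (j + 1) * 2 ^ (x + 2 * σ * D) := by
    have e1 : (2 : ℝ) ^ x ≤ 2 ^ (x + 2 * σ * D) := by
      apply Real.rpow_le_rpow_of_exponent_le (by norm_num)
      have : 0 ≤ 2 * σ * D := by positivity
      linarith
    have e2 : (j : ℝ) * 2 ^ ((1 - σ) * j + 2 * σ * D) ≤ j * 2 ^ (x + 2 * σ * D) := by
      gcongr
      norm_num
    linarith
  have h2 : 2 ^ j * (collatzT^[j] m : ℝ) ≤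
      (2 : ℝ) ^ j * ((j + 1) * 2 ^ (x - (1 - σ) * j + 4 * σ * D)) := by
    rw [h1, three_pow]
    calc (2 : ℝ) ^ (2 * σ * oddCount j m) * (m + corr j m)
        ≤ 2 ^ (σ * j + 2 * σ * D) * ((j + 1) * 2 ^ (x + 2 * σ * D)) := by
          have := corr_nonneg j m
          gcongr
          · norm_num
          · nlinarith
      _ = (j + 1) * 2 ^ (j + (x - (1 - σ) * j + 4 * σ * D)) := by
          rw [mul_left_comm, ← Real.rpow_add (by norm_num)]
          ring_nf
      _ = _ := by
          rw [Real.rpow_add (by norm_num), Real.rpow_natCast]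
          ring
  exact le_of_mul_le_mul_left h2 (by positivity)

/-! ### Counting preimages -/

/-- Among orbits of length `n` whose odd steps are evenly spread up to an error `D`, at most
`(n + 1) * 2 ^ k` end in a given point. Here `k` may be chosen close to `(1 - σ) * n`, and then
this number is close to the mean `2 ^ ((1 - σ) * n)`. -/
lemma card_le_of_iterate_mem {n k : ℕ} {D : ℝ} (hkn : k ≤ n) (S B : Finset ℕ)
    (hS : ∀ m ∈ S, ∀ j ≤ n, |(oddCount j m : ℝ) - j / 2| ≤ D) (hB : ∀ m ∈ S, collatzT^[n] m ∈ B)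
    (hk : (n : ℝ) * 2 ^ ((1 - σ) * n + 6 * σ * D) < 2 ^ (k : ℝ)) :
    S.card ≤ B.card * ((n + 1) * 2 ^ k) := by
  obtain ⟨L, rfl⟩ := Nat.exists_eq_add_of_le hkn
  have hσ := σ_pos
  have hsmall : ∀ m ∈ S, corr L (collatzT^[k] m) < 3 ^ oddCount k m := by
    intro m hm
    have hk1 := (abs_le.mp (hS m hm k hkn))
    have hc := corr_le (j := L) (m := collatzT^[k] m) (D := 2 * D) (by
      intro i hi
      have h1 := (abs_le.mp (hS m hm (k + i) (by omega)))
      rw [oddCount_add] at h1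
      push_cast at h1
      linarith [h1.1, hk1.2])
    refine hc.trans_lt ?_
    rw [three_pow]
    have e1 : (2 : ℝ) ^ (σ * k - 2 * σ * D) ≤ 2 ^ (2 * σ * oddCount k m) := by
      apply Real.rpow_le_rpow_of_exponent_le (by norm_num)
      nlinarith [hk1.1]
    refine lt_of_lt_of_le ?_ e1
    have e2 : (0 : ℝ) < 2 ^ ((1 - σ) * k + 2 * σ * D) := by positivity
    refine lt_of_mul_lt_mul_right ?_ e2.le
    calc (L : ℝ) * 2 ^ ((1 - σ) * L + 2 * σ * (2 * D)) * 2 ^ ((1 - σ) * k + 2 * σ * D)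
        = L * 2 ^ ((1 - σ) * (k + L : ℕ) + 6 * σ * D) := by
          rw [mul_assoc, ← Real.rpow_add (by norm_num)]
          push_cast
          ring_nf
      _ ≤ (k + L : ℕ) * 2 ^ ((1 - σ) * (k + L : ℕ) + 6 * σ * D) := by
          gcongr
          omega
      _ < 2 ^ (k : ℝ) := hk
      _ = _ := by
          rw [← Real.rpow_add (by norm_num)]
          ring_nf
  rw [show B.card * ((k + L + 1) * 2 ^ k) =
    (B ×ˢ (Finset.range (k + L + 1) ×ˢ Finset.range (2 ^ k))).card by
      simp [Finset.card_product]]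
  refine Finset.card_le_card_of_injOn
    (fun m => (collatzT^[k + L] m, oddCount (k + L) m, m % 2 ^ k)) ?_ ?_
  · intro m hm
    have := oddCount_le (k + L) m
    simp only [Finset.coe_product, Set.mem_prod, Finset.mem_coe, Finset.mem_range]
    exact ⟨hB m hm, by omega, Nat.mod_lt _ (by positivity)⟩
  · intro m hm m' hm' h
    simp only [Prod.mk.injEq] at h
    exact eq_of_iterate_eq h.2.2 h.1 h.2.1 (hsmall m hm) (hsmall m' hm')

/-! ### Exceptional starting points -/

/-- Exponentials eventually dominate linear functions. -/
lemma eventually_mul_le_two_rpow (C : ℝ) {δ : ℝ} (hδ : 0 < δ) :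
    ∀ᶠ n : ℕ in atTop, C * ((n : ℝ) + 1) ≤ 2 ^ (δ * n) := by
  have h : (1 : ℝ) < 2 ^ δ := Real.one_lt_rpow (by norm_num) hδ
  have h1 : Tendsto (fun n : ℕ => C * ((n : ℝ) / (2 ^ δ) ^ n + 1 / (2 ^ δ) ^ n)) atTop
      (𝓝 (C * (0 + 0))) := by
    refine Tendsto.const_mul _ (Tendsto.add ?_ ?_)
    · simpa only [pow_one] using tendsto_pow_const_div_const_pow_of_one_lt 1 h
    · simpa only [pow_zero] using tendsto_pow_const_div_const_pow_of_one_lt 0 h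
  have h2 := h1.eventually_lt_const (u := 1) (by norm_num)
  filter_upwards [h2] with n hn
  rw [Real.rpow_mul (by norm_num), Real.rpow_natCast]
  rw [← add_div, mul_div_assoc', div_lt_one (by positivity)] at hn
  exact hn.le

/-- The starting points below `2 ^ n` for which, within the first `K * n` steps, the number of odd
steps at some time `j` differs from `j / 2` by more than `ε * n`. -/
noncomputable def bad (K ε : ℝ) (n : ℕ) : Finset ℕ :=
  open Classical in (Finset.range (2 ^ n)).filter
    (fun m => ∃ j : ℕ, (j : ℝ) ≤ K * n ∧ ε * n < |(oddCount j m : ℝ) - j / 2|)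

lemma mem_bad {K ε : ℝ} {n m : ℕ} : m ∈ bad K ε n ↔ m < 2 ^ n ∧
    ∃ j : ℕ, (j : ℝ) ≤ K * n ∧ ε * n < |(oddCount j m : ℝ) - j / 2| := by
  simp [bad]

lemma bad_mono {K K' ε ε' : ℝ} (hK : K ≤ K') (hε : ε' ≤ ε) (n : ℕ) : bad K ε n ⊆ bad K' ε' n := by
  intro m hm
  rw [mem_bad] at hm ⊢
  obtain ⟨h, j, h1, h2⟩ := hm
  exact ⟨h, j, h1.trans (by gcongr), lt_of_le_of_lt (by gcongr) h2⟩

/-- Up to time `K * n`, odd and even steps are balanced for all starting points below `2 ^ n`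
outside an exceptional set that is smaller by a power. -/
def Balanced (K : ℝ) : Prop :=
  ∀ ε > (0 : ℝ), ∃ δ > (0 : ℝ), ∀ᶠ n : ℕ in atTop, ((bad K ε n).card : ℝ) ≤ 2 ^ ((1 - δ) * n)

lemma Balanced.mono {K K' : ℝ} (h : Balanced K') (hK : K ≤ K') : Balanced K := by
  intro ε hε
  obtain ⟨δ, hδ, h1⟩ := h ε hε
  refine ⟨δ, hδ, h1.mono fun n hn => le_trans ?_ hn⟩
  exact_mod_cast Finset.card_le_card (bad_mono hK le_rfl n)

lemma balanced_zero : Balanced 0 := by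
  intro ε hε
  refine ⟨1, one_pos, Eventually.of_forall fun n => ?_⟩
  have : bad 0 ε n = ∅ := by
    rw [Finset.eq_empty_iff_forall_notMem]
    intro m hm
    obtain ⟨-, j, h1, h2⟩ := mem_bad.mp hm
    have : j = 0 := by
      rw [zero_mul] at h1
      exact_mod_cast le_antisymm h1 (Nat.cast_nonneg j)
    subst this
    have : 0 ≤ ε * n := by positivity
    simp at h2
    linarith
  rw [this]
  simp

/-- Over the first `n` steps the parities behave like fair coin tosses. -/
lemma balanced_one : Balanced 1 := by
  intro ε hε
  have hl : 0 < Real.log 2 := Real.log_pos (by norm_num)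
  refine ⟨ε ^ 2 / Real.log 2, by positivity, ?_⟩
  filter_upwards [eventually_mul_le_two_rpow 2 (δ := ε ^ 2 / Real.log 2) (by positivity)] with n hn
  have h1 : bad 1 ε n ⊆ (Finset.range (n + 1)).biUnion (fun j => (Finset.range (2 ^ n)).filter
      (fun m => ε * n < |(oddCount j m : ℝ) - j / 2|)) := by
    intro m hm
    obtain ⟨h, j, h1, h2⟩ := mem_bad.mp hm
    rw [one_mul, Nat.cast_le] at h1
    simp only [Finset.mem_biUnion, Finset.mem_range, Finset.mem_filter]
    exact ⟨j, by omega, h, h2⟩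
  have h2 : ((bad 1 ε n).card : ℝ) ≤ ∑ j ∈ Finset.range (n + 1),
      (((Finset.range (2 ^ n)).filter
        (fun m => ε * n < |(oddCount j m : ℝ) - j / 2|)).card : ℝ) := by
    exact_mod_cast (Finset.card_le_card h1).trans Finset.card_biUnion_le
  have h3 := Finset.sum_le_card_nsmul (Finset.range (n + 1)) _ _
    (fun j hj => card_deviation_le ε hε (n := n) (Finset.mem_range_succ_iff.mp hj))
  rw [Finset.card_range, nsmul_eq_mul] at h3
  have h4 : Real.exp (-2 * ε ^ 2 * n) = 2 ^ (-2 * (ε ^ 2 / Real.log 2 * n)) := by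
    rw [Real.rpow_def_of_pos (by norm_num)]
    congr 1
    field_simp
  rw [h4] at h3
  calc ((bad 1 ε n).card : ℝ) ≤ _ := h2
    _ ≤ _ := h3
    _ = 2 * ((n : ℝ) + 1) * 2 ^ ((n : ℝ) + -2 * (ε ^ 2 / Real.log 2 * n)) := by
        rw [Real.rpow_add (by norm_num), Real.rpow_natCast]; push_cast; ring
    _ ≤ 2 ^ (ε ^ 2 / Real.log 2 * n) * 2 ^ ((n : ℝ) + -2 * (ε ^ 2 / Real.log 2 * n)) := by
        gcongr
    _ = _ := by
        rw [← Real.rpow_add (by norm_num)]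
        ring_nf

/-! ### Extending the time range -/

lemma tendsto_ceil_mul_atTop {c : ℝ} (hc : 0 < c) :
    Tendsto (fun n : ℕ => ⌈c * n⌉₊) atTop atTop :=
  tendsto_nat_ceil_atTop.comp (tendsto_natCast_atTop_atTop.const_mul_atTop hc)

lemma abs_le_of_notMem_bad {K ε : ℝ} {n m j : ℕ} (hm : m < 2 ^ n) (hb : m ∉ bad K ε n)
    (hj : (j : ℝ) ≤ K * n) : |(oddCount j m : ℝ) - j / 2| ≤ ε * n := by
  by_contra! hlt
  exact hb (mem_bad.mpr ⟨hm, j, hj, hlt⟩)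

/-- The exceptional starting points for times up to `n + K * n'`: either the first `n` steps are
irregular already, or they lead to a point below `2 ^ n'` whose first `K * n'` steps are. -/
lemma bad_subset_union {K ε η : ℝ} {n n' : ℕ} (hK : 0 ≤ K) (hη : 0 < η) (hηε : η ≤ ε / 2)
    (hn : (n : ℝ) + 1 < 2 ^ (η * n)) (hn' : (σ + 5 * η) * n ≤ n') (hn'n : (n' : ℝ) ≤ n) :
    bad (1 + σ * K) ε n ⊆ bad 1 η n ∪ (Finset.range (2 ^ n)).filter
      (fun m => m ∉ bad 1 η n ∧ collatzT^[n] m ∈ bad K (ε / 2) n') := by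
  have hσ := σ_pos
  have hσ1 := σ_lt_one
  have hηn : 0 ≤ η * n := by positivity
  intro m hm
  obtain ⟨hm1, j, hj, hdev⟩ := mem_bad.mp hm
  rw [Finset.mem_union]
  by_contra! hcon
  obtain ⟨hb, hmS⟩ := hcon
  have hg : ∀ j ≤ n, |(oddCount j m : ℝ) - j / 2| ≤ η * n := fun j hj =>
    abs_le_of_notMem_bad hm1 hb (by rw [one_mul]; exact_mod_cast hj)
  have hz : collatzT^[n] m ∉ bad K (ε / 2) n' := fun hz => hmS (by
    rw [Finset.mem_filter, Finset.mem_range]; exact ⟨hm1, hb, hz⟩)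
  have e4 : η * n ≤ ε / 2 * n := by gcongr
  rcases le_total j n with hjn | hjn
  · have := hg j hjn
    linarith
  · obtain ⟨i, rfl⟩ := Nat.exists_eq_add_of_le hjn
    have hzlt : collatzT^[n] m < 2 ^ n' := by
      have e1 := iterate_le (x := n) (by positivity) hg
        (by rw [Real.rpow_natCast]; exact_mod_cast hm1.le) (by nlinarith)
      have e3 : (collatzT^[n] m : ℝ) < 2 ^ (n' : ℝ) := by
        calc (collatzT^[n] m : ℝ) ≤ _ := e1
          _ < 2 ^ (η * n) * 2 ^ ((n : ℝ) - (1 - σ) * n + 4 * σ * (η * n)) := by gcongr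
          _ = 2 ^ (η * n + ((n : ℝ) - (1 - σ) * n + 4 * σ * (η * n))) :=
            (Real.rpow_add (by norm_num) _ _).symm
          _ ≤ 2 ^ (n' : ℝ) := by
            apply Real.rpow_le_rpow_of_exponent_le (by norm_num)
            nlinarith
      rw [Real.rpow_natCast] at e3
      exact_mod_cast e3
    have hi : (i : ℝ) ≤ K * n' := by
      push_cast at hj
      have : K * (σ * n) ≤ K * n' := by
        gcongr
        linarith
      linarith
    have hdev2 := abs_le_of_notMem_bad hzlt hz hi
    have hdev1 := hg n le_rfl
    have e5 : ε / 2 * n' ≤ ε / 2 * n := by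
      have : 0 ≤ ε / 2 := by linarith
      gcongr
    rw [oddCount_add] at hdev
    push_cast at hdev
    have e6 := abs_add_le ((oddCount n m : ℝ) - n / 2)
      ((oddCount i (collatzT^[n] m) : ℝ) - i / 2)
    rw [show (oddCount n m : ℝ) - n / 2 + (oddCount i (collatzT^[n] m) - i / 2) =
      oddCount n m + oddCount i (collatzT^[n] m) - (n + i) / 2 by ring] at e6
    linarith

/-- Few starting points with regular first `n` steps are mapped into a given small set `B`. -/
lemma card_filter_iterate_mem_le {η : ℝ} {n k : ℕ} (B : Finset ℕ) (hη : 0 < η)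
    (hn : (n : ℝ) + 1 < 2 ^ (η * n)) (hk : ((1 - σ) + 7 * η) * n ≤ k) (hkn : k ≤ n) :
    ((Finset.range (2 ^ n)).filter (fun m => m ∉ bad 1 η n ∧ collatzT^[n] m ∈ B)).card ≤
      B.card * ((n + 1) * 2 ^ k) := by
  have hσ1 := σ_lt_one
  have hηn : 0 ≤ η * n := by positivity
  refine card_le_of_iterate_mem (D := η * n) hkn _ _ ?_ ?_ ?_
  · intro m hm j hj
    rw [Finset.mem_filter, Finset.mem_range] at hm
    exact abs_le_of_notMem_bad hm.1 hm.2.1 (by rw [one_mul]; exact_mod_cast hj)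
  · intro m hm
    exact (Finset.mem_filter.mp hm).2.2
  · have e2 : (n : ℝ) < 2 ^ (η * n) := by linarith
    calc (n : ℝ) * 2 ^ ((1 - σ) * n + 6 * σ * (η * n))
        < 2 ^ (η * n) * 2 ^ ((1 - σ) * n + 6 * σ * (η * n)) := by gcongr
      _ = 2 ^ (η * n + ((1 - σ) * n + 6 * σ * (η * n))) :=
        (Real.rpow_add (by norm_num) _ _).symm
      _ ≤ 2 ^ (k : ℝ) := by
        apply Real.rpow_le_rpow_of_exponent_le (by norm_num)
        nlinarith

/-- The exponents that occur when an exceptional set of size `2 ^ ((1 - δ) * n')` is pulled back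
along `n ≈ n' / σ` steps: the power saving `δ` survives. -/
lemma mul_two_pow_le {b δ η : ℝ} {n n' k : ℕ} (hδ : 0 < δ) (hη : 0 < η) (hηδ : 28 * η ≤ δ * σ)
    (hb : b ≤ 2 ^ ((1 - δ) * n')) (hn : 4 * ((n : ℝ) + 1) ≤ 2 ^ (η * n))
    (hn'1 : (σ + 5 * η) * n ≤ n') (hn'2 : (n' : ℝ) < (σ + 5 * η) * n + 1)
    (hk : (k : ℝ) < ((1 - σ) + 7 * η) * n + 1) :
    b * ((n + 1) * 2 ^ k) ≤ 2 ^ ((1 - δ * σ / 2) * n) := by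
  have hηn : 0 ≤ η * n := by positivity
  have e1 : b ≤ 2 ^ ((1 - δ) * (σ * n) + 5 * (η * n) + 1) := by
    refine hb.trans ?_
    apply Real.rpow_le_rpow_of_exponent_le (by norm_num)
    have : δ * (σ * n) ≤ δ * n' := by gcongr; linarith
    linarith
  have e2 : (2 : ℝ) ^ k ≤ 2 ^ (((1 - σ) + 7 * η) * n + 1) := by
    rw [← Real.rpow_natCast]
    exact Real.rpow_le_rpow_of_exponent_le (by norm_num) hk.le
  have e3 : (2 : ℝ) ^ ((1 - δ) * (σ * n) + 5 * (η * n) + 1) * 2 ^ (((1 - σ) + 7 * η) * n + 1) =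
      4 * 2 ^ ((1 - δ * σ) * n + 12 * (η * n)) := by
    rw [show (4 : ℝ) = 2 ^ (2 : ℝ) by norm_num, ← Real.rpow_add (by norm_num),
      ← Real.rpow_add (by norm_num)]
    ring_nf
  calc b * ((n + 1) * 2 ^ k) ≤ 2 ^ ((1 - δ) * (σ * n) + 5 * (η * n) + 1) *
        ((n + 1) * 2 ^ (((1 - σ) + 7 * η) * n + 1)) := by gcongr
    _ = 4 * ((n : ℝ) + 1) * 2 ^ ((1 - δ * σ) * n + 12 * (η * n)) := by
      linear_combination ((n : ℝ) + 1) * e3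
    _ ≤ 2 ^ (η * n) * 2 ^ ((1 - δ * σ) * n + 12 * (η * n)) := by gcongr
    _ = 2 ^ (η * n + ((1 - δ * σ) * n + 12 * (η * n))) := (Real.rpow_add (by norm_num) _ _).symm
    _ ≤ _ := by
      apply Real.rpow_le_rpow_of_exponent_le (by norm_num)
      have : 28 * η * n ≤ δ * σ * n := by gcongr
      linarith

/-- If the first `n` steps are regular, then `T^n m` lies below `2 ^ n'` with `n'` close to `σ * n`,
and the bound on the number of preimages shows that only few regular `m` lead to an exceptional
value there; all others stay regular for another `K * n'` steps. -/
lemma Balanced.one_add_σ_mul {K : ℝ} (hK : 0 ≤ K) (h : Balanced K) : Balanced (1 + σ * K) := by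
  intro ε hε
  have hσ := σ_pos
  have hσ1 : 0 < 1 - σ := by linarith [σ_lt_one]
  obtain ⟨δ, hδ, hbad⟩ := h (ε / 2) (by positivity)
  -- The tolerance `η` for the first `n` steps costs a factor of about `2 ^ (13 * η * n)`, which has
  -- to be small against the gain `2 ^ (δ * σ * n)`.
  obtain ⟨η, hη, hη1, hη2, hη3, hη4⟩ : ∃ η > (0 : ℝ), η ≤ ε / 2 ∧ 14 * η ≤ σ ∧ 10 * η ≤ 1 - σ ∧
      28 * η ≤ δ * σ := by
    have hev : ∀ c : ℝ, 0 < c → ∀ᶠ η in 𝓝[>] (0 : ℝ), η < c := fun c hc =>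
      eventually_nhdsWithin_of_eventually_nhds (eventually_lt_nhds hc)
    obtain ⟨η, h0, h1, h2, h3, h4⟩ := (eventually_mem_nhdsWithin.and
      ((hev (ε / 2) (by positivity)).and ((hev (σ / 14) (by positivity)).and
        ((hev ((1 - σ) / 10) (by positivity)).and (hev (δ * σ / 28) (by positivity)))))).exists
    exact ⟨η, h0, by linarith, by linarith, by linarith, by linarith⟩
  obtain ⟨δ₁, hδ₁, hfirst⟩ := balanced_one η hη
  set θ := min δ₁ (δ * σ / 2) / 2 with hθdef
  have hθ : 0 < θ := by positivity
  have hθ1 : 2 * θ ≤ δ₁ := by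
    have := min_le_left δ₁ (δ * σ / 2)
    linarith
  have hθ2 : 2 * θ ≤ δ * σ / 2 := by
    have := min_le_right δ₁ (δ * σ / 2)
    linarith
  refine ⟨θ, hθ, ?_⟩
  filter_upwards [hfirst,
    (tendsto_ceil_mul_atTop (by positivity : 0 < σ + 5 * η)).eventually hbad,
    eventually_mul_le_two_rpow 4 hη, eventually_mul_le_two_rpow 2 hθ,
    tendsto_natCast_atTop_atTop.eventually_ge_atTop (2 / σ),
    tendsto_natCast_atTop_atTop.eventually_ge_atTop (2 / (1 - σ))] with n h1 h2 h3 h4 h5 h6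
  rw [div_le_iff₀ hσ] at h5
  rw [div_le_iff₀ hσ1] at h6
  have hn0 : (0 : ℝ) ≤ n := Nat.cast_nonneg n
  set n' := ⌈(σ + 5 * η) * n⌉₊
  have hn'1 : (σ + 5 * η) * n ≤ n' := Nat.le_ceil _
  have hn'2 : (n' : ℝ) < (σ + 5 * η) * n + 1 := Nat.ceil_lt_add_one (by positivity)
  have hn'3 : (n' : ℝ) ≤ n := by
    have : 10 * η * n ≤ (1 - σ) * n := by gcongr
    linarith
  set k := ⌈((1 - σ) + 7 * η) * n⌉₊
  have hk1 : ((1 - σ) + 7 * η) * n ≤ k := Nat.le_ceil _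
  have hk2 : (k : ℝ) < ((1 - σ) + 7 * η) * n + 1 := Nat.ceil_lt_add_one (by positivity)
  have hkn : k ≤ n := by
    have : 14 * η * n ≤ σ * n := by gcongr
    have : (k : ℝ) ≤ n := by linarith
    exact_mod_cast this
  have hn : (n : ℝ) + 1 < 2 ^ (η * n) := by linarith
  have hcover := bad_subset_union hK hη hη1 hn hn'1 hn'3
  have hS := card_filter_iterate_mem_le (bad K (ε / 2) n') hη hn hk1 hkn
  have hB := mul_two_pow_le hδ hη hη4 h2 h3 hn'1 hn'2 hk2
  set S := (Finset.range (2 ^ n)).filter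
    (fun m => m ∉ bad 1 η n ∧ collatzT^[n] m ∈ bad K (ε / 2) n')
  have hS' : (S.card : ℝ) ≤ 2 ^ ((1 - δ * σ / 2) * n) :=
    le_trans (by exact_mod_cast hS) hB
  have e1 : (2 : ℝ) ^ ((1 - δ₁) * n) ≤ 2 ^ ((1 - 2 * θ) * n) := by
    apply Real.rpow_le_rpow_of_exponent_le (by norm_num)
    gcongr
  have e2 : (2 : ℝ) ^ ((1 - δ * σ / 2) * n) ≤ 2 ^ ((1 - 2 * θ) * n) := by
    apply Real.rpow_le_rpow_of_exponent_le (by norm_num)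
    gcongr
  calc ((bad (1 + σ * K) ε n).card : ℝ) ≤ (bad 1 η n).card + S.card := by
        exact_mod_cast (Finset.card_le_card hcover).trans (Finset.card_union_le _ _)
    _ ≤ 2 * 2 ^ ((1 - 2 * θ) * n) := by linarith
    _ ≤ 2 ^ (θ * n) * 2 ^ ((1 - 2 * θ) * n) := by
        gcongr
        linarith
    _ = _ := by
        rw [← Real.rpow_add (by norm_num)]
        ring_nf

/-- The fixed point `1 / (1 - σ)` of `K ↦ 1 + σ * K` is approached by iteration from `0`. -/
lemma balanced_of_lt {K : ℝ} (hK : K < 1 / (1 - σ)) : Balanced K := by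
  have hσ := σ_pos
  have hσ1 := σ_lt_one
  have h1 : 0 < 1 - σ := by linarith
  have hr : ∀ r : ℕ, 0 ≤ (1 - σ ^ r) / (1 - σ) ∧ Balanced ((1 - σ ^ r) / (1 - σ)) := by
    intro r
    induction r with
    | zero => simpa using balanced_zero
    | succ r ih =>
      have e : (1 - σ ^ (r + 1)) / (1 - σ) = 1 + σ * ((1 - σ ^ r) / (1 - σ)) := by
        field_simp
        ring
      rw [e]
      exact ⟨by have := ih.1; positivity, ih.2.one_add_σ_mul ih.1⟩
  have ht : Tendsto (fun r : ℕ => (1 - σ ^ r) / (1 - σ)) atTop (𝓝 ((1 - 0) / (1 - σ))) :=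
    ((tendsto_pow_atTop_nhds_zero_of_lt_one hσ.le hσ1).const_sub 1).div_const _
  rw [sub_zero] at ht
  obtain ⟨r, h⟩ := (ht.eventually_const_lt hK).exists
  exact (hr r).2.mono h.le

/-- The endpoint `K = 1 / (1 - σ)` is included, since a few more steps change the count of odd
steps only slightly. -/
lemma balanced_limit : Balanced (1 / (1 - σ)) := by
  intro ε hε
  have hσ1 : 0 < 1 - σ := by linarith [σ_lt_one]
  set K := 1 / (1 - σ) with hKdef
  have hK : 0 < K := by positivity
  obtain ⟨δ, hδ, h⟩ := balanced_of_lt (K := K - min (ε / 2) K)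
    (by have : 0 < min (ε / 2) K := by positivity
        linarith) (ε / 2) (by positivity)
  refine ⟨δ, hδ, ?_⟩
  filter_upwards [h, tendsto_natCast_atTop_atTop.eventually_ge_atTop (2 / ε)] with n hn h2
  refine le_trans ?_ hn
  rw [div_le_iff₀ hε] at h2
  have hsub : bad K ε n ⊆ bad (K - min (ε / 2) K) (ε / 2) n := by
    intro m hm
    obtain ⟨hm1, j, hj, hdev⟩ := mem_bad.mp hm
    by_contra hcon
    have hg : ∀ i : ℕ, (i : ℝ) ≤ (K - min (ε / 2) K) * n →
        |(oddCount i m : ℝ) - i / 2| ≤ ε / 2 * n := fun i hi =>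
      abs_le_of_notMem_bad hm1 hcon hi
    have hnn : (0 : ℝ) ≤ (K - min (ε / 2) K) * n :=
      mul_nonneg (by linarith [min_le_right (ε / 2) K]) (Nat.cast_nonneg n)
    -- Truncating at time `j₀` misses at most `ε / 2 * n + 1` steps.
    set j₀ := ⌊(K - min (ε / 2) K) * n⌋₊
    have hj₀ : (j₀ : ℝ) ≤ (K - min (ε / 2) K) * n := Nat.floor_le hnn
    have hj₀' : (K - min (ε / 2) K) * n < j₀ + 1 := Nat.lt_floor_add_one _
    have hεn : 0 ≤ ε / 2 * n := by positivity
    rcases le_total j j₀ with hjj | hjj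
    · have := hg j (le_trans (by exact_mod_cast hjj) hj₀)
      linarith
    · obtain ⟨i, rfl⟩ := Nat.exists_eq_add_of_le hjj
      have e0 := abs_le.mp (hg j₀ hj₀)
      have e1 : (oddCount i (collatzT^[j₀] m) : ℝ) ≤ i := by exact_mod_cast oddCount_le _ _
      have e2 : (0 : ℝ) ≤ oddCount i (collatzT^[j₀] m) := Nat.cast_nonneg _
      have e3 : min (ε / 2) K * n ≤ ε / 2 * n := by gcongr; exact min_le_left _ _
      rw [oddCount_add] at hdev
      push_cast at hdev hj
      rcases lt_abs.mp hdev with h' | h' <;> linarith [e0.1, e0.2]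
  exact_mod_cast Finset.card_le_card hsub

/-! ### From balanced parities to natural density -/

/-- A trajectory whose odd and even steps are balanced up to `η * n` follows the predicted power law
up to `m ^ ε`. -/
lemma rpow_bounds_of_balanced {n m k : ℕ} {η ε l x : ℝ} (hη : 0 ≤ η) (hx : (2 : ℝ) ^ x = m)
    (hxn : 10 * (η * n) ≤ ε * x)
    (hdev : ∀ i ≤ k, |(oddCount i m : ℝ) - i / 2| ≤ η * n)
    (hk : (1 - σ) * k ≤ (1 - l) * x) (hk' : (1 - l) * x ≤ (1 - σ) * (k + 1))
    (hkx : (1 - σ) * k ≤ x) (hkn : 2 * ((k : ℝ) + 1) ≤ 2 ^ (η * n)) :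
    (m : ℝ) ^ (l - ε) ≤ (collatzT^[k] m : ℝ) ∧ (collatzT^[k] m : ℝ) ≤ (m : ℝ) ^ (l + ε) := by
  have hσ := σ_pos
  have hσ1 := σ_lt_one
  have hηn : 0 ≤ η * n := by positivity
  have hσηn : 0 ≤ σ * (η * n) := by positivity
  have hσηn' : σ * (η * n) ≤ η * n := by nlinarith
  constructor
  · refine le_trans ?_ (le_iterate (x := x) (D := η * n)
      (by linarith [(abs_le.mp (hdev k le_rfl)).1]) hx.le)
    rw [← hx, ← Real.rpow_mul (by norm_num)]
    apply Real.rpow_le_rpow_of_exponent_le (by norm_num)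
    linarith
  · refine (iterate_le (x := x) hηn hdev hx.ge hkx).trans ?_
    have e1 : (k : ℝ) + 1 ≤ 2 ^ (η * n - 1) := by
      rw [Real.rpow_sub (by norm_num), Real.rpow_one]
      linarith
    calc ((k : ℝ) + 1) * 2 ^ (x - (1 - σ) * k + 4 * σ * (η * n))
        ≤ 2 ^ (η * n - 1) * 2 ^ (x - (1 - σ) * k + 4 * σ * (η * n)) := by gcongr
      _ = 2 ^ (η * n - 1 + (x - (1 - σ) * k + 4 * σ * (η * n))) :=
        (Real.rpow_add (by norm_num) _ _).symm
      _ ≤ 2 ^ (x * (l + ε)) := by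
        apply Real.rpow_le_rpow_of_exponent_le (by norm_num)
        linarith
      _ = _ := by rw [Real.rpow_mul (by norm_num), hx]

/-- A set of positive integers has natural density one if, below `2 ^ n`, its complement has at most
`2 ^ ((1 - δ) * n)` elements for some `δ > 0` and all large `n`. -/
lemma hasNaturalDensityOne_of_card_le {A : Set ℕ} (E : ℕ → Finset ℕ)
    {δ : ℝ} (hδ : 0 < δ) (hE : ∀ᶠ n : ℕ in atTop, ((E n).card : ℝ) ≤ 2 ^ ((1 - δ) * n))
    (hA : ∀ᶠ n : ℕ in atTop, ∀ m, 0 < m → m < 2 ^ n → m ∉ E n → m ∈ A) :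
    HasNaturalDensityOne A := by
  refine Tendsto.liminf_eq ?_
  have hlog : Tendsto (fun M : ℕ => Nat.log 2 M + 1) atTop atTop := by
    refine tendsto_atTop.mpr fun b => ?_
    filter_upwards [eventually_ge_atTop (2 ^ b)] with M hM
    have := Nat.le_log_of_pow_le (by norm_num) hM
    omega
  have hlim : Tendsto (fun n : ℕ => 1 - 2 * ((2 : ℝ) ^ (-δ)) ^ n) atTop (𝓝 1) := by
    have h1 : (2 : ℝ) ^ (-δ) < 1 := Real.rpow_lt_one_of_one_lt_of_neg (by norm_num) (by linarith)
    have := ((tendsto_pow_atTop_nhds_zero_of_lt_one (by positivity) h1).const_mul 2).const_sub 1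
    simpa using this
  refine tendsto_of_tendsto_of_tendsto_of_le_of_le' (hlim.comp hlog) tendsto_const_nhds ?_ ?_
  · filter_upwards [hlog.eventually hE, hlog.eventually hA, eventually_gt_atTop 0] with M h1 h2 hM
    simp only [Function.comp_apply]
    set n := Nat.log 2 M + 1
    have hMn : M < 2 ^ n := Nat.lt_pow_succ_log_self (by norm_num) M
    have hnM : 2 ^ n ≤ 2 * M := by
      rw [pow_succ']
      exact Nat.mul_le_mul_left 2 (Nat.pow_log_le_self 2 hM.ne')
    have hcov : Set.Icc 1 M ⊆ (A ∩ Set.Icc 1 M) ∪ (E n : Set ℕ) := by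
      intro m hm
      by_cases hmE : m ∈ E n
      · exact Or.inr hmE
      · exact Or.inl ⟨h2 m hm.1 (hm.2.trans_lt hMn) hmE, hm⟩
    have hfin : ((A ∩ Set.Icc 1 M) ∪ (E n : Set ℕ)).Finite :=
      ((Set.finite_Icc 1 M).inter_of_right A).union (E n).finite_toSet
    have hc := (Set.ncard_le_ncard hcov hfin).trans (Set.ncard_union_le _ _)
    rw [Set.ncard_coe_finset, ← Finset.coe_Icc, Set.ncard_coe_finset, Nat.card_Icc,
      Nat.add_sub_cancel] at hc
    have hc' : (M : ℝ) ≤ (A ∩ (Finset.Icc 1 M : Set ℕ)).ncard + (E n).card := by exact_mod_cast hc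
    rw [Finset.coe_Icc] at hc'
    have hM' : (0 : ℝ) < M := by exact_mod_cast hM
    have hnM' : (2 : ℝ) ^ n ≤ 2 * M := by exact_mod_cast hnM
    rw [le_div_iff₀ hM']
    have e1 : (2 : ℝ) ^ ((1 - δ) * n) = 2 ^ n * (2 ^ (-δ)) ^ n := by
      rw [← Real.rpow_natCast, ← Real.rpow_natCast, ← Real.rpow_mul (by norm_num),
        ← Real.rpow_add (by norm_num)]
      ring_nf
    have e2 : (2 : ℝ) ^ n * (2 ^ (-δ)) ^ n ≤ 2 * M * (2 ^ (-δ)) ^ n := by gcongr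
    linarith
  · filter_upwards with M
    refine div_le_one_of_le₀ ?_ (Nat.cast_nonneg M)
    have := Set.ncard_le_ncard (Set.inter_subset_right (s := A)) (Set.finite_Icc 1 M)
    rw [← Finset.coe_Icc, Set.ncard_coe_finset, Nat.card_Icc, Nat.add_sub_cancel] at this
    rw [← Finset.coe_Icc]
    exact_mod_cast this

end Collatz

theorem mainTheorem2 (ε : ℝ) (hε : 0 < ε) :
    HasNaturalDensityOne
      {m : ℕ | 0 < m ∧ ∀ l : ℝ, l ∈ Set.Icc (0 : ℝ) 1 →
        (m : ℝ) ^ (l - ε) ≤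
            ((collatzT^[⌊(1 - l) / (1 - Real.logb 2 (Real.sqrt 3)) * Real.logb 2 (m : ℝ)⌋₊] m : ℕ) : ℝ) ∧
          ((collatzT^[⌊(1 - l) / (1 - Real.logb 2 (Real.sqrt 3)) * Real.logb 2 (m : ℝ)⌋₊] m : ℕ) : ℝ) ≤
            (m : ℝ) ^ (l + ε)} := by
  change HasNaturalDensityOne {m : ℕ | 0 < m ∧ ∀ l : ℝ, l ∈ Set.Icc (0 : ℝ) 1 →
    (m : ℝ) ^ (l - ε) ≤ (collatzT^[⌊(1 - l) / (1 - Collatz.σ) * Real.logb 2 m⌋₊] m : ℝ) ∧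
    (collatzT^[⌊(1 - l) / (1 - Collatz.σ) * Real.logb 2 m⌋₊] m : ℝ) ≤ (m : ℝ) ^ (l + ε)}
  have hσ1 : 0 < 1 - Collatz.σ := by linarith [Collatz.σ_lt_one]
  -- With `log₂ m ≥ n / 2`, this choice gives `10 * η * n ≤ ε * log₂ m`.
  set η := ε / 20 with hη
  have hη0 : 0 < η := by positivity
  obtain ⟨δ, hδ, hbad⟩ := Collatz.balanced_limit η hη0
  set θ := min δ (1 / 2) / 2 with hθdef
  have hθ : 0 < θ := by positivity
  have hθ1 : 2 * θ ≤ δ := by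
    have := min_le_left δ (1 / 2)
    linarith
  have hθ2 : 2 * θ ≤ 1 / 2 := by
    have := min_le_right δ (1 / 2)
    linarith
  -- Starting points below `2 ^ (n / 2)` are discarded as well, to have `log₂ m` comparable to `n`.
  refine Collatz.hasNaturalDensityOne_of_card_le
    (fun n => Collatz.bad (1 / (1 - Collatz.σ)) η n ∪ Finset.range ⌈(2 : ℝ) ^ ((n : ℝ) / 2)⌉₊)
    hθ ?_ ?_
  · filter_upwards [hbad, Collatz.eventually_mul_le_two_rpow 3 hθ] with n h1 h2
    have hn0 : (0 : ℝ) ≤ n := Nat.cast_nonneg n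
    have e1 : ((⌈(2 : ℝ) ^ ((n : ℝ) / 2)⌉₊ : ℕ) : ℝ) ≤ 2 * 2 ^ ((1 - 2 * θ) * n) := by
      have a1 : (1 : ℝ) ≤ 2 ^ ((n : ℝ) / 2) := Real.one_le_rpow (by norm_num) (by positivity)
      have a2 : (2 : ℝ) ^ ((n : ℝ) / 2) ≤ 2 ^ ((1 - 2 * θ) * n) := by
        apply Real.rpow_le_rpow_of_exponent_le (by norm_num)
        nlinarith
      have a3 := Nat.ceil_lt_add_one (zero_le_one.trans a1)
      linarith
    have e2 : (2 : ℝ) ^ ((1 - δ) * n) ≤ 2 ^ ((1 - 2 * θ) * n) := by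
      apply Real.rpow_le_rpow_of_exponent_le (by norm_num)
      gcongr
    calc _ ≤ ((Collatz.bad (1 / (1 - Collatz.σ)) η n).card : ℝ) +
            (Finset.range ⌈(2 : ℝ) ^ ((n : ℝ) / 2)⌉₊).card := by
          exact_mod_cast Finset.card_union_le _ _
      _ ≤ 3 * 2 ^ ((1 - 2 * θ) * n) := by
          rw [Finset.card_range]
          linarith
      _ ≤ 2 ^ (θ * n) * 2 ^ ((1 - 2 * θ) * n) := by
          gcongr
          linarith
      _ = _ := by
          rw [← Real.rpow_add (by norm_num)]
          ring_nf
  · filter_upwards [Collatz.eventually_mul_le_two_rpow (2 * (1 / (1 - Collatz.σ) + 1)) hη0]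
      with n hn m hm hmn hmE
    rw [Finset.mem_union, not_or, Finset.mem_range, not_lt, Nat.ceil_le] at hmE
    obtain ⟨hmb, hml⟩ := hmE
    refine ⟨hm, fun l hl => ?_⟩
    have hm' : (0 : ℝ) < m := by exact_mod_cast hm
    set x := Real.logb 2 (m : ℝ) with hxdef
    have hx : (2 : ℝ) ^ x = m := Real.rpow_logb (by norm_num) (by norm_num) hm'
    have hxn : (n : ℝ) / 2 ≤ x := (Real.le_logb_iff_rpow_le (by norm_num) hm').mpr hml
    have hxn' : x ≤ n := by
      rw [hxdef, Real.logb_le_iff_le_rpow (by norm_num) hm', Real.rpow_natCast]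
      exact_mod_cast hmn.le
    have hn0 : (0 : ℝ) ≤ n := Nat.cast_nonneg n
    have hx0 : 0 ≤ x := le_trans (by positivity) hxn
    have hl1 : 0 ≤ 1 - l := by linarith [hl.2]
    set k := ⌊(1 - l) / (1 - Collatz.σ) * x⌋₊
    have hk1 : (k : ℝ) ≤ (1 - l) / (1 - Collatz.σ) * x := Nat.floor_le (by positivity)
    have hk2 : (1 - l) / (1 - Collatz.σ) * x < k + 1 := Nat.lt_floor_add_one _
    rw [div_mul_eq_mul_div] at hk1 hk2
    rw [le_div_iff₀ hσ1] at hk1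
    rw [div_lt_iff₀ hσ1] at hk2
    have hkx : (1 - Collatz.σ) * k ≤ x := by nlinarith [hl.1]
    have hkn : (k : ℝ) ≤ 1 / (1 - Collatz.σ) * n := by
      rw [div_mul_eq_mul_div, le_div_iff₀ hσ1]
      linarith
    refine Collatz.rpow_bounds_of_balanced (n := n) (x := x) hη0.le hx ?_ ?_ (by linarith)
      (by linarith) hkx ?_
    · rw [hη]
      nlinarith
    · exact fun i hi => Collatz.abs_le_of_notMem_bad hmn hmb
        (le_trans (by exact_mod_cast hi) hkn)
    · refine le_trans ?_ hn
      have : 0 ≤ 1 / (1 - Collatz.σ) := by positivity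
      nlinarith
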